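/- For positive integers $n,k$, a geometric $(n_k)$ configuration is a set of $n$ distinct points and $n$ distinct straight lines in the real Euclidean plane such that each of the points lies on exactly $k$ of the lines and each of the lines passes through exactly $k$ of the points. For every integer $k \ge 2$ the number $N_k$ exists, where $N_k$ denotes the smallest number $N$ such that a geometric $(n_k)$ configuration exists for every integer $n \ge N$. -/

import Mathlib

/-- The real Euclidean plane. -/
abbrev Plane : Type := EuclideanSpace ℝ (Fin 2)

/-- `IsGeometricConfiguration n k P L`: the set `P` of points and the set `L` of straight lines of
the real plane form a geometric `(n_k)` configuration, that is, there are `n` (distinct) points and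
`n` (distinct) lines, every point of `P` lies on exactly `k` of the lines, and every line of `L`
passes through exactly `k` of the points. Incidence is actual geometric incidence. -/
structure IsGeometricConfiguration (n k : ℕ) (P : Finset Plane)
    (L : Finset (AffineSubspace ℝ Plane)) : Prop where
  /-- Every member of `L` is a line. (The empty affine subspace has direction of rank `0`.) -/
  isLine : ∀ l ∈ L, Module.finrank ℝ l.direction = 1
  card_points : P.card = n
  card_lines : L.card = n
  lines_through : ∀ p ∈ P, {l : AffineSubspace ℝ Plane | l ∈ L ∧ p ∈ l}.ncard = k
  points_on : ∀ l ∈ L, {p : Plane | p ∈ P ∧ p ∈ l}.ncard = k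

/-- The number `n` is `k`-realizable if a geometric `(n_k)` configuration exists. -/
def IsRealizable (k n : ℕ) : Prop :=
  ∃ (P : Finset Plane) (L : Finset (AffineSubspace ℝ Plane)), IsGeometricConfiguration n k P L

/-- `IsThreshold k N` says that `N` is the number `N_k`: the smallest number `N` such that a
geometric `(n_k)` configuration exists for every `n ≥ N`. -/
def IsThreshold (k N : ℕ) : Prop :=
  IsLeast {M : ℕ | ∀ n : ℕ, M ≤ n → IsRealizable k n} N

/-! Induction on `k`, starting from the trivial case `k = 1`. From an `(m_k)` configuration in
general position, `replicate` makes a configuration of type `k + 1` with `(k + 2) * m` points, `m`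
of whose lines are vertical and avoid every point of the `x`-axis in it. Applying `switch` to any `r
≤ m` of these gives `k * (k + 2) * m + r` points and as many lines. With `d = k * (k + 2)`, every
`n` in `[d * m, d * m + m]` is thus realizable, and these intervals leave no gap once `m ≥ d`. Lines
are written `x - B = A * y` because `B` is then the intersection with the `x`-axis, which strains
along `y` preserve, and `A = 0` means vertical. -/

open Filter

/-- Points `(X i, Y i)` and lines `x - B j = A j * y` forming a configuration in which every point
lies on exactly `k` lines and every line passes through exactly `k` points. -/
structure IsCoordConfiguration (k : ℕ) {ι κ : Type} (X Y : ι → ℝ) (B A : κ → ℝ) : Prop where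
  point_inj : ∀ i i', X i = X i' → Y i = Y i' → i = i'
  line_inj : ∀ j j', B j = B j' → A j = A j' → j = j'
  lines_through : ∀ i, Nat.card {j // X i - B j = A j * Y i} = k
  points_on : ∀ j, Nat.card {i // X i - B j = A j * Y i} = k

/-- There is a configuration of `n` points and `n` non-horizontal lines in coordinates. -/
def CoordRealizable (k n : ℕ) : Prop :=
  ∃ (ι κ : Type) (_ : Finite ι) (_ : Finite κ) (X Y : ι → ℝ) (B A : κ → ℝ),
    Nat.card ι = n ∧ Nat.card κ = n ∧ IsCoordConfiguration k X Y B A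

/-- A nonzero affine function of `c` has at most one root. Each unwanted coincidence below is affine
in a free parameter, so a generic value avoids them all. -/
theorem eventually_affine_eq_zero_imp {τ : Type} [Finite τ] (α β : τ → ℝ) :
    ∀ᶠ c : ℝ in cofinite, ∀ t, α t + c * β t = 0 → α t = 0 ∧ β t = 0 := by
  rw [eventually_all]
  intro t
  by_cases hβ : β t = 0
  · exact Eventually.of_forall fun c h => ⟨by simpa [hβ] using h, hβ⟩
  · refine (Set.finite_singleton (-α t / β t)).subset fun c hc => ?_
    simp only [Set.mem_compl_iff, Set.mem_ofPred_eq, Classical.not_imp] at hc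
    rw [Set.mem_singleton_iff, eq_div_iff hβ]
    linarith [hc.1]

/-! ### Counting -/

theorem card_subtype_sum {α β : Type} [Finite α] [Finite β] (p : α ⊕ β → Prop) :
    Nat.card {s // p s} = Nat.card {a // p (.inl a)} + Nat.card {b // p (.inr b)} := by
  rw [Nat.card_congr (Equiv.subtypeSum (p := p)), Nat.card_sum]

theorem card_subtype_fiber {α β : Type} (p : α → Prop) (t : β) :
    Nat.card {q : α × β // q.2 = t ∧ p q.1} = Nat.card {a // p a} :=
  Nat.card_congr
    { toFun := fun q => ⟨q.1.1, q.2.2⟩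
      invFun := fun a => ⟨(a.1, t), rfl, a.2⟩
      left_inv := by rintro ⟨⟨a, b⟩, rfl, h⟩; rfl
      right_inv := fun _ => rfl }

theorem card_subtype_fst_eq {α β : Type} (a : α) :
    Nat.card {q : α × β // q.1 = a} = Nat.card β :=
  Nat.card_congr
    { toFun := fun q => q.1.2
      invFun := fun b => ⟨(a, b), rfl⟩
      left_inv := by rintro ⟨⟨a, b⟩, rfl⟩; rfl
      right_inv := fun _ => rfl }

theorem card_subtype_eq' {α : Type} (a : α) : Nat.card {b : α // b = a} = 1 := by
  simp

theorem card_subtype_false {α : Type} {p : α → Prop} (h : ∀ a, ¬ p a) :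
    Nat.card {a // p a} = 0 := by
  have : IsEmpty {a // p a} := ⟨fun a => h a.1 a.2⟩
  exact Nat.card_of_isEmpty

theorem card_subtype_congr {α : Type} {p q : α → Prop} (h : ∀ a, p a ↔ q a) :
    Nat.card {a // p a} = Nat.card {a // q a} :=
  Nat.card_congr (Equiv.subtypeEquivRight h)

/-! ### General position -/

theorem IsCoordConfiguration.shear {k : ℕ} {ι κ : Type} {X Y : ι → ℝ} {B A : κ → ℝ}
    (h : IsCoordConfiguration k X Y B A) (s t : ℝ) :
    IsCoordConfiguration k (fun i => X i + s * (Y i + t)) (fun i => Y i + t)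
      (fun j => B j - t * A j) (fun j => A j + s) := by
  have inc : ∀ i j, X i + s * (Y i + t) - (B j - t * A j) = (A j + s) * (Y i + t) ↔
      X i - B j = A j * Y i := fun i j =>
    ⟨fun e => by linear_combination e, fun e => by linear_combination e⟩
  refine ⟨fun i i' hX hY => ?_, fun j j' hB hA => ?_, fun i => ?_, fun j => ?_⟩
  · have hY' : Y i = Y i' := by linarith
    exact h.point_inj _ _ (by simpa [hY'] using hX) hY'
  · have hA' : A j = A j' := by linarith
    exact h.line_inj _ _ (by simpa [hA'] using hB) hA'
  · rw [card_subtype_congr (inc i), h.lines_through]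
  · rw [card_subtype_congr (inc · j), h.points_on]

theorem IsCoordConfiguration.exists_general_position {k : ℕ} {ι κ : Type} [Finite ι] [Finite κ]
    {X Y : ι → ℝ} {B A : κ → ℝ} (h : IsCoordConfiguration k X Y B A) :
    ∃ (X' Y' : ι → ℝ) (B' A' : κ → ℝ), IsCoordConfiguration k X' Y' B' A' ∧
      Function.Injective X' ∧ Function.Injective B' ∧ (∀ i, Y' i ≠ 0) ∧ (∀ j, A' j ≠ 0) ∧
      ∀ i j, X' i ≠ B' j := by
  -- The shift `t` comes first: the shear by `s` fixes the new `x`-axis, so it leaves `B'` alone,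
  -- and it can separate points from the `B' j` only if `Y i + t ≠ 0`.
  obtain ⟨t, htY, htB⟩ := ((eventually_affine_eq_zero_imp Y (fun _ => 1)).and
    (eventually_affine_eq_zero_imp (fun q : κ × κ => B q.1 - B q.2)
      (fun q => A q.2 - A q.1))).exists
  have hY : ∀ i, Y i + t ≠ 0 := fun i e => one_ne_zero (htY i (by linarith)).2
  obtain ⟨s, hsA, hsX, hsB⟩ := ((eventually_affine_eq_zero_imp A (fun _ => 1)).and
    ((eventually_affine_eq_zero_imp (fun q : ι × ι => X q.1 - X q.2)
      (fun q => Y q.1 - Y q.2)).and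
    (eventually_affine_eq_zero_imp (fun q : ι × κ => X q.1 - (B q.2 - t * A q.2))
      (fun q => Y q.1 + t)))).exists
  refine ⟨_, _, _, _, h.shear s t, fun i i' e => ?_, fun j j' e => ?_, hY, fun j e => ?_,
    fun i j e => ?_⟩
  · dsimp only at e
    have := hsX (i, i') (by linear_combination e)
    exact h.point_inj _ _ (sub_eq_zero.1 this.1) (sub_eq_zero.1 this.2)
  · dsimp only at e
    have := htB (j, j') (by linear_combination e)
    exact h.line_inj _ _ (sub_eq_zero.1 this.1) (sub_eq_zero.1 this.2).symm
  · exact one_ne_zero (hsA j (by linarith)).2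
  · exact hY i (hsB (i, j) (by linear_combination e)).2

/-! ### Affine replication -/

/-- Affine replication: copies of the configuration under strains along the `y`-axis, together with
the points where its lines meet the `x`-axis and the vertical lines through its points. -/
theorem IsCoordConfiguration.replicate {k : ℕ} {ι κ : Type} [Finite ι] [Finite κ]
    {X Y : ι → ℝ} {B A : κ → ℝ} (h : IsCoordConfiguration k X Y B A)
    (hX : Function.Injective X) (hB : Function.Injective B) (hY : ∀ i, Y i ≠ 0)
    (hA : ∀ j, A j ≠ 0) (hXB : ∀ i j, X i ≠ B j) :
    ∃ m : Fin (k + 1) → ℝ, (∀ t, m t ≠ 0) ∧ IsCoordConfiguration (k + 1)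
      (Sum.elim (fun q : ι × Fin (k + 1) => X q.1) B)
      (Sum.elim (fun q : ι × Fin (k + 1) => m q.2 * Y q.1) fun _ => 0)
      (Sum.elim (fun q : κ × Fin (k + 1) => B q.1) X)
      (Sum.elim (fun q : κ × Fin (k + 1) => A q.1 / m q.2) fun _ => 0) := by
  -- The strain factors are `t + c`. Incidence between copies `t` and `u` is affine in `c`; if both
  -- coefficients vanish, then `(X i - B j) * (u - t) = 0`, so `u = t`.
  obtain ⟨c, hc, hinc⟩ := ((eventually_affine_eq_zero_imp
      (fun t : Fin (k + 1) => (t : ℝ)) (fun _ => 1)).and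
    (eventually_affine_eq_zero_imp
      (fun q : (ι × κ) × (Fin (k + 1) × Fin (k + 1)) =>
        (X q.1.1 - B q.1.2) * (q.2.2 : ℝ) - A q.1.2 * Y q.1.1 * (q.2.1 : ℝ))
      (fun q => X q.1.1 - B q.1.2 - A q.1.2 * Y q.1.1))).exists
  have hm : ∀ t : Fin (k + 1), (t : ℝ) + c ≠ 0 := fun t e =>
    one_ne_zero (hc t (by linarith)).2
  have hcast : ∀ t u : Fin (k + 1), (t : ℝ) = (u : ℝ) → t = u := fun t u e =>
    Fin.ext (by exact_mod_cast e)
  have inc : ∀ i j (t u : Fin (k + 1)),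
      X i - B j = A j / (u + c) * ((t + c) * Y i) ↔ u = t ∧ X i - B j = A j * Y i := by
    intro i j t u
    constructor
    · intro e
      rw [div_mul_eq_mul_div, eq_div_iff (hm u)] at e
      obtain ⟨e1, e2⟩ := hinc ((i, j), (t, u)) (by dsimp only; linear_combination e)
      dsimp only at e1 e2
      have e3 : (X i - B j) * ((u : ℝ) - t) = 0 := by linear_combination e1 - t * e2
      refine ⟨hcast _ _ (sub_eq_zero.1 ?_), by linarith⟩
      exact (mul_eq_zero.1 e3).resolve_left (sub_ne_zero.2 (hXB i j))
    · rintro ⟨rfl, e⟩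
      rw [e]
      field_simp [hm u]
  refine ⟨fun t => t + c, hm, ?_, ?_, ?_, ?_⟩
  · rintro (⟨i, t⟩ | j) (⟨i', t'⟩ | j') h1 h2 <;>
      simp only [Sum.elim_inl, Sum.elim_inr] at h1 h2
    · obtain rfl := hX h1
      have := mul_right_cancel₀ (hY i) h2
      rw [hcast t t' (by linarith)]
    · exact absurd h1 (hXB _ _)
    · exact absurd h1.symm (hXB _ _)
    · rw [hB h1]
  · rintro (⟨j, t⟩ | i) (⟨j', t'⟩ | i') h1 h2 <;>
      simp only [Sum.elim_inl, Sum.elim_inr] at h1 h2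
    · obtain rfl := hB h1
      rw [div_eq_div_iff (hm t) (hm t')] at h2
      have := mul_left_cancel₀ (hA j) h2
      rw [hcast t t' (by linarith)]
    · exact absurd h1.symm (hXB _ _)
    · exact absurd h1 (hXB _ _)
    · rw [hX h1]
  · rintro (⟨i, t⟩ | j) <;> rw [card_subtype_sum] <;>
      simp only [Sum.elim_inl, Sum.elim_inr, zero_mul, mul_zero, sub_eq_zero (b := B _),
        sub_eq_zero (b := X _)]
    · rw [card_subtype_congr (q := fun q : κ × Fin (k + 1) => q.2 = t ∧ X i - B q.1 = A q.1 * Y i)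
        (fun q => by rw [← inc, sub_eq_iff_eq_add]),
        card_subtype_fiber (fun j => X i - B j = A j * Y i), h.lines_through,
        card_subtype_congr (q := (· = i)) (fun i' => ⟨fun e => hX e.symm, fun e => by rw [e]⟩),
        card_subtype_eq']
    · rw [card_subtype_congr (q := fun q : κ × Fin (k + 1) => q.1 = j)
        (fun q => ⟨fun e => hB e.symm, fun e => by rw [e]⟩), card_subtype_fst_eq, Nat.card_fin,
        card_subtype_false fun i e => hXB i j e.symm]
  · rintro (⟨j, u⟩ | i) <;> rw [card_subtype_sum] <;>
      simp only [Sum.elim_inl, Sum.elim_inr, zero_mul, mul_zero, sub_eq_zero (b := B _),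
        sub_eq_zero (b := X _)]
    · rw [card_subtype_congr (q := fun q : ι × Fin (k + 1) => q.2 = u ∧ X q.1 - B j = A j * Y q.1)
        (fun q => by rw [inc, eq_comm]),
        card_subtype_fiber (fun i => X i - B j = A j * Y i), h.points_on,
        card_subtype_congr (q := (· = j)) (fun j' => ⟨fun e => hB e, fun e => by rw [e]⟩),
        card_subtype_eq']
    · rw [card_subtype_congr (q := fun q : ι × Fin (k + 1) => q.1 = i)
        (fun q => ⟨fun e => hX e, fun e => by rw [e]⟩), card_subtype_fst_eq, Nat.card_fin,
        card_subtype_false fun j e => hXB i j e.symm]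

/-! ### Affine switch -/

theorem card_subtype_add_compl {α : Type} [Finite α] (S : Set α) (p : α → Prop) :
    Nat.card {a : ↥(Sᶜ) // p a} + Nat.card {a : S // p a} = Nat.card {a // p a} := by
  classical
  rw [add_comm, ← Nat.card_congr ((Equiv.Set.sumCompl S).subtypeEquiv
    (p := fun x => p (Equiv.Set.sumCompl S x)) fun _ => Iff.rfl), card_subtype_sum]
  simp only [Equiv.Set.sumCompl_apply_inl, Equiv.Set.sumCompl_apply_inr]

theorem card_pairs_snd_eq {α β : Type} (R : α → β → Prop) (b : β) :
    Nat.card {q : {q : α × β // R q.1 q.2} // q.1.2 = b} = Nat.card {a // R a b} :=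
  Nat.card_congr
    { toFun := fun q => ⟨q.1.1.1, by obtain ⟨⟨_, h⟩, rfl⟩ := q; exact h⟩
      invFun := fun a => ⟨⟨(a.1, b), a.2⟩, rfl⟩
      left_inv := by rintro ⟨⟨⟨a, b⟩, h⟩, rfl⟩; rfl
      right_inv := fun _ => rfl }

theorem card_pairs_fst_eq {α β : Type} (R : α → β → Prop) (a : α) :
    Nat.card {q : {q : α × β // R q.1 q.2} // q.1.1 = a} = Nat.card {b // R a b} :=
  Nat.card_congr
    { toFun := fun q => ⟨q.1.1.2, by obtain ⟨⟨_, h⟩, rfl⟩ := q; exact h⟩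
      invFun := fun b => ⟨⟨(a, b.1), b.2⟩, rfl⟩
      left_inv := by rintro ⟨⟨⟨a, b⟩, h⟩, rfl⟩; rfl
      right_inv := fun _ => rfl }

theorem card_pairs {α β : Type} [Finite α] [Finite β] {R : α → β → Prop} {k : ℕ}
    (h : ∀ a, Nat.card {b // R a b} = k) :
    Nat.card {q : α × β // R q.1 q.2} = Nat.card α * k := by
  have := Fintype.ofFinite α
  rw [Nat.card_congr (Equiv.subtypeProdEquivSigmaSubtype R), Nat.card_sigma]
  simp [h]

/-- Affine switch: `k` affine copies of the configuration in which the vertical lines in `S` are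
deleted and, for each of them, replaced by a pencil of `k + 1` lines with a new centre. -/
theorem IsCoordConfiguration.switch {k : ℕ} {ι κ : Type} [Finite ι] [Finite κ]
    {X Y : ι → ℝ} {B A : κ → ℝ} (h : IsCoordConfiguration (k + 1) X Y B A) (S : Set κ)
    (hA : ∀ j ∈ S, A j = 0) (hY : ∀ j ∈ S, ∀ i, X i - B j = A j * Y i → Y i ≠ 0) :
    ∃ c : ℝ, IsCoordConfiguration (k + 1)
      (Sum.elim (fun q : ι × Fin k => X q.1 - c * q.2) fun s : S => B s + c)
      (Sum.elim (fun q : ι × Fin k => (q.2 + 1) * Y q.1) fun _ : S => 0)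
      (Sum.elim (fun q : ↥(Sᶜ) × Fin k => B q.1 - c * q.2)
        fun q : {q : S × ι // X q.2 - B q.1 = A q.1 * Y q.2} => B q.1.1 + c)
      (Sum.elim (fun q : ↥(Sᶜ) × Fin k => A q.1 / (q.2 + 1))
        fun q : {q : S × ι // X q.2 - B q.1 = A q.1 * Y q.2} => -c / Y q.1.2) := by
  -- A generic `c` keeps the copies free of common points, common lines and cross incidences, and
  -- keeps the new centres and pencils off everything unintended.
  obtain ⟨c, hc, hpp, hll, hpl, hnl, hnn, hpn⟩ :=
    ((eventually_affine_eq_zero_imp (fun _ : Unit => 0) (fun _ => 1)).and <|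
    (eventually_affine_eq_zero_imp (fun q : (ι × ι) × (Fin k × Fin k) => X q.1.1 - X q.1.2)
      (fun q => (q.2.2 : ℝ) - q.2.1)).and <|
    (eventually_affine_eq_zero_imp (fun q : (κ × κ) × (Fin k × Fin k) => B q.1.1 - B q.1.2)
      (fun q => (q.2.2 : ℝ) - q.2.1)).and <|
    (eventually_affine_eq_zero_imp (fun q : (ι × κ) × (Fin k × Fin k) =>
        X q.1.1 - B q.1.2 - A q.1.2 / ((q.2.2 : ℝ) + 1) * (((q.2.1 : ℝ) + 1) * Y q.1.1))
      (fun q => (q.2.2 : ℝ) - q.2.1)).and <|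
    (eventually_affine_eq_zero_imp (fun q : (κ × ι) × Fin k => B q.1.1 - X q.1.2)
      (fun q => (q.2 : ℝ) + 1)).and <|
    (eventually_affine_eq_zero_imp (fun q : (κ × κ) × Fin k => B q.1.1 - B q.1.2)
      (fun q => (q.2 : ℝ) + 1)).and <|
    (eventually_affine_eq_zero_imp (fun q : (ι × ι × κ) × Fin k => X q.1.1 - B q.1.2.2)
      (fun q => ((q.2 : ℝ) + 1) * (Y q.1.1 / Y q.1.2.1 - 1)))).exists
  have hc0 : c ≠ 0 := fun e => one_ne_zero (hc () (by simp [e])).2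
  have hcast : ∀ t u : Fin k, (t : ℝ) = (u : ℝ) → t = u := fun t u e =>
    Fin.ext (by exact_mod_cast e)
  have hm : ∀ t : Fin k, (t : ℝ) + 1 ≠ 0 := fun t => by positivity
  have hnew : ∀ q : {q : S × ι // X q.2 - B q.1 = A q.1 * Y q.2},
      Y q.1.2 ≠ 0 ∧ X q.1.2 = B q.1.1 ∧ A q.1.1 = 0 := fun q =>
    ⟨hY _ q.1.1.2 _ q.2, by have := q.2; rw [hA _ q.1.1.2] at this; linarith, hA _ q.1.1.2⟩
  have hBS : ∀ s s' : S, B s = B s' → s = s' := fun s s' e =>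
    Subtype.ext (h.line_inj _ _ e (by rw [hA _ s.2, hA _ s'.2]))
  have inc : ∀ i (j : κ) (t u : Fin k),
      X i - c * t - (B j - c * u) = A j / (u + 1) * ((t + 1) * Y i) ↔
        u = t ∧ X i - B j = A j * Y i := by
    intro i j t u
    have hcancel : A j / (u + 1) * (((u : ℝ) + 1) * Y i) = A j * Y i := by
      have := hm u
      field_simp
    constructor
    · intro e
      obtain ⟨e1, e2⟩ := hpl ((i, j), (t, u)) (by dsimp only; linear_combination e)
      dsimp only at e1 e2
      obtain rfl := hcast _ _ (sub_eq_zero.1 e2)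
      exact ⟨rfl, by rw [← hcancel]; linarith⟩
    · rintro ⟨rfl, e⟩
      rw [hcancel]
      linarith
  -- The images `(X - c * t, (t + 1) * Y)` of one point are collinear, and `t = -1` gives the centre
  -- `(B + c, 0)`.
  have incNewLine : ∀ i (t : Fin k) (q : {q : S × ι // X q.2 - B q.1 = A q.1 * Y q.2}),
      X i - c * t - (B q.1.1 + c) = -c / Y q.1.2 * ((t + 1) * Y i) ↔ i = q.1.2 := by
    intro i t q
    obtain ⟨hq, hq', -⟩ := hnew q
    constructor
    · intro e
      obtain ⟨e1, e2⟩ := hpn ((i, q.1.2, q.1.1), t) (by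
        dsimp only
        linear_combination e)
      dsimp only at e1 e2
      have e3 := sub_eq_zero.1 ((mul_eq_zero.1 e2).resolve_left (hm t))
      rw [div_eq_one_iff_eq hq] at e3
      exact h.point_inj _ _ (by linarith) e3
    · rintro rfl
      rw [hq']
      field_simp
      ring
  have incNewPoint : ∀ (s : S) (j : κ) (u : Fin k), B s + c - (B j - c * u) ≠ 0 := by
    intro s j u e
    exact hm u (hnn ((s, j), u) (by dsimp only; linear_combination e)).2
  refine ⟨c, ?_, ?_, ?_, ?_⟩
  · rintro (⟨i, t⟩ | s) (⟨i', t'⟩ | s') h1 h2 <;>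
      simp only [Sum.elim_inl, Sum.elim_inr] at h1 h2
    · obtain ⟨e1, e2⟩ := hpp ((i, i'), (t, t')) (by dsimp only; linear_combination h1)
      dsimp only at e1 e2
      obtain rfl := hcast _ _ (sub_eq_zero.1 e2)
      rw [h.point_inj i i' (sub_eq_zero.1 e1) (mul_left_cancel₀ (hm _) h2)]
    · exact absurd (hnl ((s', i), t) (by dsimp only; linear_combination -h1)).2 (hm t)
    · exact absurd (hnl ((s, i'), t') (by dsimp only; linear_combination h1)).2 (hm t')
    · rw [hBS s s' (by linarith)]
  · rintro (⟨j, t⟩ | q) (⟨j', t'⟩ | q') h1 h2 <;>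
      simp only [Sum.elim_inl, Sum.elim_inr] at h1 h2
    · obtain ⟨e1, e2⟩ := hll ((j, j'), (t, t')) (by dsimp only; linear_combination h1)
      dsimp only at e1 e2
      obtain rfl := hcast _ _ (sub_eq_zero.1 e2)
      rw [div_left_inj' (hm _)] at h2
      rw [Subtype.ext (h.line_inj j j' (sub_eq_zero.1 e1) h2)]
    · exact absurd (sub_eq_zero.2 h1.symm) (incNewPoint _ _ _)
    · exact absurd (sub_eq_zero.2 h1) (incNewPoint _ _ _)
    · obtain ⟨hq1, hq2, -⟩ := hnew q
      obtain ⟨hq1', hq2', -⟩ := hnew q'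
      have e1 := hBS _ _ (add_right_cancel h1)
      rw [div_eq_div_iff hq1 hq1'] at h2
      have e2 := mul_left_cancel₀ (neg_ne_zero.2 hc0) h2
      have e3 : q.1.2 = q'.1.2 := h.point_inj _ _ (by rw [hq2, hq2', e1]) e2.symm
      rw [Subtype.ext (Prod.ext e1 e3)]
  · rintro (⟨i, t⟩ | s) <;> rw [card_subtype_sum] <;> simp only [Sum.elim_inl, Sum.elim_inr]
    · rw [card_subtype_congr
        -- Each deleted line through `i` is compensated by exactly one new line through every image
        -- of `i`.
        (q := fun q : ↥(Sᶜ) × Fin k => q.2 = t ∧ X i - B q.1 = A q.1 * Y i)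
        (fun q => inc i q.1 t q.2),
        card_subtype_fiber (fun j : ↥(Sᶜ) => X i - B j = A j * Y i),
        card_subtype_congr (fun q => (incNewLine i t q).trans eq_comm),
        card_pairs_snd_eq fun (j : S) i => X i - B j = A j * Y i, card_subtype_add_compl S
        fun j => X i - B j = A j * Y i, h.lines_through i]
    · rw [card_subtype_false fun q e => incNewPoint s q.1 q.2 (by simpa using e), zero_add,
        card_subtype_congr (q := fun q => q.1.1 = s) fun q => ?_]
      · rw [card_pairs_fst_eq fun (j : S) i => X i - B j = A j * Y i, h.points_on s]
      · rw [mul_zero, sub_eq_zero, add_left_inj]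
        exact ⟨fun e => (hBS _ _ e).symm, fun e => by rw [e]⟩
  · rintro (⟨j, u⟩ | q) <;> rw [card_subtype_sum] <;> simp only [Sum.elim_inl, Sum.elim_inr]
    · rw [card_subtype_congr
        (q := fun q : ι × Fin k => q.2 = u ∧ X q.1 - B j = A j * Y q.1)
        (fun q => by rw [inc, eq_comm]),
        card_subtype_fiber (fun i => X i - B j = A j * Y i), h.points_on,
        card_subtype_false fun s e => incNewPoint s j u (by simpa using e)]
    -- A new line carries the `k` images of one point and one centre.
    · rw [card_subtype_congr (fun p : ι × Fin k => incNewLine p.1 p.2 q), card_subtype_fst_eq,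
        Nat.card_fin, card_subtype_congr (q := fun s => s = q.1.1) fun s => ?_, card_subtype_eq']
      rw [mul_zero, sub_eq_zero, add_left_inj]
      exact ⟨fun e => hBS _ _ e, fun e => by rw [e]⟩

/-! ### Realizable numbers -/

theorem coordRealizable_one (n : ℕ) : CoordRealizable 1 n := by
  refine ⟨Fin n, Fin n, inferInstance, inferInstance, fun i => i, fun _ => 0, fun j => j,
    fun _ => 0, Nat.card_fin n, Nat.card_fin n, ?_⟩
  have hcast : ∀ i j : Fin n, (i : ℝ) - (j : ℝ) = 0 * 0 ↔ i = j := fun i j => by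
    rw [mul_zero, sub_eq_zero, Nat.cast_inj, Fin.ext_iff]
  refine ⟨fun i i' e _ => ?_, fun i i' e _ => ?_, fun i => ?_, fun j => ?_⟩
  · exact (hcast _ _).1 (by linarith)
  · exact (hcast _ _).1 (by linarith)
  · rw [card_subtype_congr (q := (· = i)) fun j => by rw [hcast, eq_comm], card_subtype_eq']
  · rw [card_subtype_congr (hcast · j), card_subtype_eq']

theorem CoordRealizable.succ {k m r : ℕ} (h : CoordRealizable k m) (hr : r ≤ m) :
    CoordRealizable (k + 1) (k * (k + 2) * m + r) := by
  classical
  obtain ⟨ι, κ, _, _, X₀, Y₀, B₀, A₀, hι, hκ, h₀⟩ := h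
  obtain ⟨X, Y, B, A, h, hX, hB, hY, hA, hXB⟩ := h₀.exists_general_position
  obtain ⟨μ, hμ, h'⟩ := h.replicate hX hB hY hA hXB
  obtain ⟨T, -, hT⟩ := Set.exists_subset_card_eq (s := (Set.univ : Set ι)) (n := r)
    (by rwa [Set.ncard_univ, hι])
  set S : Set ((κ × Fin (k + 1)) ⊕ ι) := Sum.inr '' T with hS
  have hScard : Nat.card S = r := by
    rw [Nat.card_coe_set_eq, hS, Set.ncard_image_of_injective _ Sum.inr_injective, hT]
  obtain ⟨c, h''⟩ := h'.switch S (by rintro _ ⟨i, -, rfl⟩; rfl) (by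
    -- Added points `(B j, 0)` are off the vertical lines since `X i ≠ B j`.
    rintro _ ⟨i, -, rfl⟩ (⟨i', t⟩ | j) e
    · exact mul_ne_zero (hμ t) (hY i')
    · simp only [Sum.elim_inr, zero_mul] at e
      exact absurd (sub_eq_zero.1 e).symm (hXB i j))
  refine ⟨_, _, inferInstance, inferInstance, _, _, _, _, ?_, ?_, h''⟩
  · simp only [Nat.card_sum, Nat.card_prod, Nat.card_fin, hι, hκ, hScard]
    ring
  · have hcompl : Nat.card ↥(Sᶜ) + r = (k + 2) * m := by
      have := Nat.card_congr (Equiv.Set.sumCompl S)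
      simp only [Nat.card_sum, Nat.card_prod, Nat.card_fin, hι, hκ, hScard] at this
      linarith
    rw [Nat.card_sum, Nat.card_prod, Nat.card_fin, card_pairs fun s : S => h'.points_on s, hScard]
    linear_combination k * hcompl

/-! ### Geometric configurations -/

/-- The line `x - b = a * y`. -/
noncomputable def coordLine (b a : ℝ) : AffineSubspace ℝ Plane :=
  AffineSubspace.mk' !₂[b, 0] (Submodule.span ℝ {!₂[a, 1]})

theorem mem_coordLine {b a : ℝ} {p : Plane} : p ∈ coordLine b a ↔ p 0 - b = a * p 1 := by
  rw [coordLine, AffineSubspace.mem_mk', Submodule.mem_span_singleton, vsub_eq_sub]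
  constructor
  · rintro ⟨t, ht⟩
    have h0 := congr_arg (fun v : Plane => v 0) ht
    have h1 := congr_arg (fun v : Plane => v 1) ht
    simp at h0 h1
    rw [← h0, ← h1, mul_comm]
  · intro e
    refine ⟨p 1, ?_⟩
    ext i
    fin_cases i
    · simp [e, mul_comm]
    · simp

theorem coordLine_inj {b a b' a' : ℝ} (e : coordLine b a = coordLine b' a') :
    b = b' ∧ a = a' := by
  have h0 : !₂[b, 0] ∈ coordLine b' a' := by rw [← e, mem_coordLine]; simp
  have h1 : !₂[b + a, 1] ∈ coordLine b' a' := by rw [← e, mem_coordLine]; simp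
  rw [mem_coordLine] at h0 h1
  simp at h0 h1
  constructor <;> linarith

theorem finrank_direction_coordLine (b a : ℝ) :
    Module.finrank ℝ (coordLine b a).direction = 1 := by
  rw [coordLine, AffineSubspace.direction_mk', finrank_span_singleton]
  intro e
  simpa using congr_arg (fun v : Plane => v 1) e

theorem CoordRealizable.isRealizable {k n : ℕ} (h : CoordRealizable k n) : IsRealizable k n := by
  classical
  obtain ⟨ι, κ, _, _, X, Y, B, A, hι, hκ, h⟩ := h
  have := Fintype.ofFinite ι
  have := Fintype.ofFinite κ
  set p : ι → Plane := fun i => !₂[X i, Y i] with hp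
  set l : κ → AffineSubspace ℝ Plane := fun j => coordLine (B j) (A j) with hl
  have hp_inj : Function.Injective p := fun i i' e => by
    have h0 := congr_arg (fun v : Plane => v 0) e
    have h1 := congr_arg (fun v : Plane => v 1) e
    simp [hp] at h0 h1
    exact h.point_inj _ _ h0 h1
  have hl_inj : Function.Injective l := fun j j' e =>
    h.line_inj _ _ (coordLine_inj e).1 (coordLine_inj e).2
  have hinc : ∀ i j, p i ∈ l j ↔ X i - B j = A j * Y i := fun i j => by
    simp [hp, hl, mem_coordLine]
  refine ⟨Finset.univ.image p, Finset.univ.image l, ?_, ?_, ?_, ?_, ?_⟩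
  · simp only [Finset.mem_image, Finset.mem_univ, true_and]
    rintro _ ⟨j, rfl⟩
    exact finrank_direction_coordLine _ _
  · rw [Finset.card_image_of_injective _ hp_inj, Finset.card_univ, ← Nat.card_eq_fintype_card, hι]
  · rw [Finset.card_image_of_injective _ hl_inj, Finset.card_univ, ← Nat.card_eq_fintype_card, hκ]
  · simp only [Finset.mem_image, Finset.mem_univ, true_and]
    rintro _ ⟨i, rfl⟩
    rw [← h.lines_through i, ← card_subtype_congr (hinc i)]
    have : {m | (∃ j, l j = m) ∧ p i ∈ m} = l '' {j | p i ∈ l j} := by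
      ext m
      constructor
      · rintro ⟨⟨j, rfl⟩, hj⟩
        exact ⟨j, hj, rfl⟩
      · rintro ⟨j, hj, rfl⟩
        exact ⟨⟨j, rfl⟩, hj⟩
    rw [this, Set.ncard_image_of_injective _ hl_inj]
    rfl
  · simp only [Finset.mem_image, Finset.mem_univ, true_and]
    rintro _ ⟨j, rfl⟩
    rw [← h.points_on j, ← card_subtype_congr (hinc · j)]
    have : {q | (∃ i, p i = q) ∧ q ∈ l j} = p '' {i | p i ∈ l j} := by
      ext q
      constructor
      · rintro ⟨⟨i, rfl⟩, hi⟩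
        exact ⟨i, hi, rfl⟩
      · rintro ⟨i, hi, rfl⟩
        exact ⟨⟨i, rfl⟩, hi⟩
    rw [this, Set.ncard_image_of_injective _ hp_inj]
    rfl

theorem exists_forall_coordRealizable (k : ℕ) (hk : 1 ≤ k) :
    ∃ N, ∀ n, N ≤ n → CoordRealizable k n := by
  induction k, hk using Nat.le_induction with
  | base => exact ⟨0, fun n _ => coordRealizable_one n⟩
  | succ k hk ih =>
    obtain ⟨N, hN⟩ := ih
    have hd : 0 < k * (k + 2) := by positivity
    -- Division of `n` by `k * (k + 2)` gives a quotient `m ≥ N` that also exceeds the remainder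
    -- `r`.
    refine ⟨k * (k + 2) * max N (k * (k + 2)), fun n hn => ?_⟩
    have hm : max N (k * (k + 2)) ≤ n / (k * (k + 2)) :=
      (Nat.le_div_iff_mul_le hd).2 (by rwa [mul_comm])
    rw [← Nat.div_add_mod n (k * (k + 2))]
    exact (hN _ ((le_max_left _ _).trans hm)).succ
      ((Nat.mod_lt _ hd).le.trans ((le_max_right _ _).trans hm))

theorem theorem1 (k : ℕ) (hk : 2 ≤ k) : ∃ N : ℕ, IsThreshold k N := by
  obtain ⟨N, hN⟩ := exists_forall_coordRealizable k (by omega)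
  have hne : {M : ℕ | ∀ n : ℕ, M ≤ n → IsRealizable k n}.Nonempty :=
    ⟨N, fun n hn => (hN n hn).isRealizable⟩
  exact ⟨_, Nat.sInf_mem hne, fun _ hM => Nat.sInf_le hM⟩
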